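/- **Proposition 5.5.** Let $B$ and $C$ be commutative unital complex Banach algebras. For such an algebra $A$, let $M(A)$ denote its maximal ideal space, i.e. the set of nonzero algebra homomorphisms $A\to\mathbb C$ with the weak-$*$ topology. An absolute neighbourhood retract (ANR) is a metrizable space $Y$ such that, for every closed embedding of $Y$ into a metrizable space $Z$, the image of $Y$ is a retract of some open neighbourhood of it in $Z$. A topological space $X$ has *trivial shape* if every continuous map from $X$ to an ANR is homotopic to a constant map (so that, in particular, $X\neq\emptyset$), and $A$ belongs to the class $\mathscr C$ if $M(A)$ has trivial shape. Let $\alpha$ be a submultiplicative norm on the complex algebra $B\otimes_{\mathbb C} C$, so that the completion $\mathfrak A:=B\,\widehat\otimes_\alpha C$ of $B\otimes_{\mathbb C} C$ with respect to $\alpha$ is a commutative unital complex Banach algebra. Assume that there is a constant $K$ such that for all $\xi\in M(B)$, all $n\in\mathbb N$ and all $b_1,\dots,b_n\in B$, $c_1,\dots,c_n\in C$, $$\Bigl\|\sum_{k=1}^n \xi(b_k)\,c_k\Bigr\|_{C}\le K\,\Bigl\|\sum_{k=1}^n (b_k\otimes 1_C)(1_B\otimes c_k)\Bigr\|_{\mathfrak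 A}. \tag{5.1}$$ If $B$ and $C$ belong to $\mathscr C$, then $\mathfrak A$ belongs to $\mathscr C$, and the space $M(B)\times M(C)$ has trivial shape. -/

import Mathlib

open scoped TensorProduct

universe u

noncomputable section

/-- `A ⊆ Z` is a neighbourhood retract of `Z`: some open `U ⊇ A` retracts onto `A`. -/
def IsNeighborhoodRetract {Z : Type u} [TopologicalSpace Z] (A : Set Z) : Prop :=
  ∃ U : Set Z, IsOpen U ∧ ∃ hAU : A ⊆ U, ∃ r : C(U, A), ∀ a : A, r ⟨a, hAU a.2⟩ = a

/-- Absolute neighbourhood retract (for the class of metrizable spaces): a metrizable space whose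
image under every closed embedding into a metrizable space is a neighbourhood retract there. -/
def IsANR (Y : Type u) [TopologicalSpace Y] : Prop :=
  TopologicalSpace.MetrizableSpace Y ∧
    ∀ (Z : Type u) [TopologicalSpace Z] [TopologicalSpace.MetrizableSpace Z] (e : Y → Z),
      Topology.IsClosedEmbedding e → IsNeighborhoodRetract (Set.range e)

/-- A space has trivial shape if every continuous map from it to an ANR is homotopic to a
constant map. (In particular such a space is nonempty, since the empty space is an ANR.) -/
def HasTrivialShape (X : Type u) [TopologicalSpace X] : Prop :=
  ∀ (Y : Type u) [TopologicalSpace Y], IsANR Y → ∀ f : C(X, Y), f.Nullhomotopic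

/-- The maximal ideal space: nonzero homomorphisms to `ℂ`, with the weak-* topology. -/
abbrev MaximalIdealSpace (A : Type u) [NormedCommRing A] [NormedAlgebra ℂ A] : Type u :=
  WeakDual.characterSpace ℂ A

/-- The class `𝒞` of commutative unital complex Banach algebras whose maximal ideal space has
trivial shape. -/
def BelongsToClassC (A : Type u) [NormedCommRing A] [NormedAlgebra ℂ A] [CompleteSpace A] : Prop :=
  HasTrivialShape (MaximalIdealSpace A)

variable {B C : Type u} [NormedCommRing B] [NormedAlgebra ℂ B]
  [NormedCommRing C] [NormedAlgebra ℂ C]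

/-- The algebra `B ⊗ C` equipped with the norm `α`. -/
def NormedTensor (_α : AlgebraNorm ℂ (B ⊗[ℂ] C)) : Type u := B ⊗[ℂ] C

namespace NormedTensor

variable (α : AlgebraNorm ℂ (B ⊗[ℂ] C))

instance instCommRing : CommRing (NormedTensor α) :=
  inferInstanceAs (CommRing (B ⊗[ℂ] C))

instance instAlgebra : Algebra ℂ (NormedTensor α) :=
  inferInstanceAs (Algebra ℂ (B ⊗[ℂ] C))

/-- The identity map from `B ⊗ C` to its normed copy. -/
def of : B ⊗[ℂ] C ≃ₐ[ℂ] NormedTensor α := AlgEquiv.refl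

instance instNormedRing : NormedRing (NormedTensor α) :=
  RingNorm.toNormedRing (R := NormedTensor α) α.toRingNorm

instance instNormedCommRing : NormedCommRing (NormedTensor α) where
  __ := instNormedRing α
  mul_comm := mul_comm

theorem norm_of (x : B ⊗[ℂ] C) : ‖of α x‖ = α x := rfl

instance instNormedAlgebra : NormedAlgebra ℂ (NormedTensor α) where
  __ := instAlgebra α
  norm_smul_le r x := (map_smul_eq_mul α r ((of α).symm x)).le

end NormedTensor

/-- `B ⊗̂_α C`: the completion of `B ⊗ C` with respect to the norm `α`. -/
abbrev CompletedTensor (α : AlgebraNorm ℂ (B ⊗[ℂ] C)) : Type u :=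
  UniformSpace.Completion (NormedTensor α)

/-- The map `b ↦ b ⊗ 1` from `B` to `B ⊗̂_α C`. -/
def CompletedTensor.inclLeft (α : AlgebraNorm ℂ (B ⊗[ℂ] C)) (b : B) : CompletedTensor α :=
  ((NormedTensor.of α (b ⊗ₜ[ℂ] (1 : C)) : NormedTensor α) : CompletedTensor α)

/-- The map `c ↦ 1 ⊗ c` from `C` to `B ⊗̂_α C`. -/
def CompletedTensor.inclRight (α : AlgebraNorm ℂ (B ⊗[ℂ] C)) (c : C) : CompletedTensor α :=
  ((NormedTensor.of α ((1 : B) ⊗ₜ[ℂ] c) : NormedTensor α) : CompletedTensor α)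

/-- With `B` and `C` regarded as subalgebras of `A` through `iB` and `iC`, there is a constant `K`
with `‖∑ ξ(bₖ) cₖ‖_C ≤ K ‖∑ bₖ cₖ‖_A` for all characters `ξ` of `B` and all finite families
`bₖ ∈ B`, `cₖ ∈ C`. -/
def SliceEstimate {A : Type u} [NormedCommRing A] (iB : B → A) (iC : C → A) : Prop :=
  ∃ K : ℝ, ∀ (ξ : MaximalIdealSpace B) (n : ℕ) (b : Fin n → B) (c : Fin n → C),
    ‖∑ k, ξ (b k) • c k‖ ≤ K * ‖∑ k, iB (b k) * iC (c k)‖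

end

/-! The slice estimate makes ξ ⊗ η bounded on B ⊗ C for all characters ξ, η, so restriction to the
two factors is a continuous bijection from the compact space M(𝔄) onto M(B) × M(C), hence a
homeomorphism. It remains to show that trivial shape passes to X × Z with Z compact Hausdorff
(`HasTrivialShape.prod`). A map X × Z → P is a map X → C(Z, P); if C(Z, P) is an ANR, this contracts
to a single map Z → P, which is null-homotopic in turn.

That C(Z, P) is an ANR rests on two facts: P embeds as a closed subset of a convex set K in a Banach
space, so a neighbourhood in K retracts onto P; and maps into convex sets extend from closed subsets
(Dugundji), applied to C(Z, K) inside C(Z, E). -/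

/-! ### Extension of maps into convex sets -/

section Dugundji

open Set Metric Filter Topology

/-- **Dugundji extension theorem**: a continuous map from a nonempty closed subset of a metric space
to a convex subset of a normed space extends to the whole space, with values in the same set. -/
theorem exists_continuous_extension_mem_convex {W E : Type*} [MetricSpace W]
    [NormedAddCommGroup E] [NormedSpace ℝ E] {A : Set W} (hA : IsClosed A) (hne : A.Nonempty)
    {K : Set E} (hK : Convex ℝ K) (f : C(A, E)) (hf : ∀ a, f a ∈ K) :
    ∃ F : C(W, E), (∀ a : A, F a = f a) ∧ ∀ w, F w ∈ K := by
  classical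
  -- The factor 2 leaves room for a point of `A` that still qualifies for all nearby `x`, so a
  -- constant selection exists locally; it also forces these sets to shrink to `f a` as `x` tends to
  -- `a`.
  let t : W → Set E := fun x => convexHull ℝ (f '' {a : A | dist (a : W) x < 2 * infDist x A})
  have hpos (x : W) (hx : x ∉ A) : 0 < infDist x A := (hA.notMem_iff_infDist_pos hne).1 hx
  obtain ⟨g, hg⟩ : ∃ g : C((Aᶜ : Set W), E), ∀ x : (Aᶜ : Set W), g x ∈ t x := by
    refine exists_continuous_forall_mem_convex_of_local_const
      (fun x => convex_convexHull ℝ _) fun x => ?_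
    obtain ⟨a, ha, hlt⟩ := (infDist_lt_iff (x := (x : W)) (r := 2 * infDist (x : W) A) hne).1
      (by linarith [hpos x x.2])
    refine ⟨f ⟨a, ha⟩, ?_⟩
    have hcont : Continuous fun y : (Aᶜ : Set W) => 2 * infDist (y : W) A - dist a y := by
      have := (continuous_infDist_pt A).comp (continuous_subtype_val (p := fun y => y ∈ Aᶜ))
      exact (continuous_const.mul this).sub (continuous_const.dist continuous_subtype_val)
    have hx : 0 < 2 * infDist (x : W) A - dist a x := by rw [dist_comm]; linarith
    filter_upwards [hcont.continuousAt.eventually (lt_mem_nhds hx)] with y hy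
    exact subset_convexHull ℝ _ ⟨⟨a, ha⟩, by simpa using hy, rfl⟩
  let F : W → E := fun x => if h : x ∈ A then f ⟨x, h⟩ else g ⟨x, h⟩
  have hFA (a : A) : F a = f a := by simp [F]
  have hFC (x : (Aᶜ : Set W)) : F x = g x := dif_neg x.2
  have hmaps (x : W) (hx : x ∉ A) : F x ∈ t x := by
    have := hg ⟨x, hx⟩
    rwa [← hFC] at this
  have hcontF : Continuous F := by
    refine continuous_iff_continuousAt.2 fun x => ?_
    by_cases hx : x ∈ A
    · rw [Metric.continuousAt_iff]
      intro ε hε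
      obtain ⟨δ, hδ, hfδ⟩ := Metric.continuousAt_iff.1 (f.continuous.continuousAt (x := ⟨x, hx⟩))
        ε hε
      -- If dist a y < 2 · infDist y A ≤ 2 · dist y x, then dist a x < 3 · dist y x.
      refine ⟨δ / 3, by positivity, fun {y} hy => ?_⟩
      have hFx : F x = f ⟨x, hx⟩ := hFA ⟨x, hx⟩
      rw [hFx]
      by_cases hyA : y ∈ A
      · rw [show F y = f ⟨y, hyA⟩ from hFA ⟨y, hyA⟩]
        exact hfδ (show dist y x < δ by linarith)
      · refine convexHull_min ?_ (convex_ball (f ⟨x, hx⟩) ε) (hmaps y hyA)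
        rintro _ ⟨a, ha, rfl⟩
        refine hfδ (show dist (a : W) x < δ from ?_)
        have h1 : dist (a : W) y < 2 * infDist y A := ha
        have h2 : infDist y A ≤ dist y x := infDist_le_dist_of_mem hx
        linarith [dist_triangle (a : W) y x]
    · have : ContinuousOn F Aᶜ := by
        rw [continuousOn_iff_continuous_domRestrict]
        exact g.continuous.congr fun y => (hFC y).symm
      exact this.continuousAt (hA.isOpen_compl.mem_nhds hx)
  refine ⟨⟨F, hcontF⟩, hFA, fun w => ?_⟩
  by_cases hw : w ∈ A
  · exact Set.mem_of_eq_of_mem (hFA ⟨w, hw⟩) (hf ⟨w, hw⟩)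
  · refine convexHull_min ?_ hK (hmaps w hw)
    rintro _ ⟨a, -, rfl⟩
    exact hf a

end Dugundji

/-! ### The Kuratowski–Wojdysławski embedding -/

section Kuratowski

open scoped BoundedContinuousFunction
open Topology

/-- The isometry `p ↦ dist p · - dist p₀ ·` of a pointed metric space into the Banach space of its
bounded continuous functions. -/
noncomputable def pointedKuratowski {P : Type*} [MetricSpace P] (p₀ p : P) : P →ᵇ ℝ :=
  BoundedContinuousFunction.ofNormedAddCommGroup (fun q => dist p q - dist p₀ q)
    (by fun_prop) (dist p p₀) fun q => abs_dist_sub_le p p₀ q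

@[simp]
theorem pointedKuratowski_apply {P : Type*} [MetricSpace P] (p₀ p q : P) :
    pointedKuratowski p₀ p q = dist p q - dist p₀ q := rfl

theorem isometry_pointedKuratowski {P : Type*} [MetricSpace P] (p₀ : P) :
    Isometry (pointedKuratowski p₀) := by
  refine Isometry.of_dist_eq fun p q => le_antisymm ?_ ?_
  · refine (BoundedContinuousFunction.dist_le dist_nonneg).2 fun x => ?_
    simpa [Real.dist_eq] using abs_dist_sub_le p q x
  · have := BoundedContinuousFunction.dist_coe_le_dist (f := pointedKuratowski p₀ p)
      (g := pointedKuratowski p₀ q) q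
    simpa [Real.dist_eq] using this

/-- A function in the convex hull of the image of the Kuratowski embedding is bounded below by a
positive multiple of the distance to some point, up to the normalisation. -/
theorem exists_mul_dist_le_of_mem_convexHull {P : Type*} [MetricSpace P] (p₀ : P) {g : P →ᵇ ℝ}
    (hg : g ∈ convexHull ℝ (Set.range (pointedKuratowski p₀))) :
    ∃ p : P, ∃ c > 0, ∀ q, c * dist p q ≤ g q + dist p₀ q := by
  -- Nonnegativity is carried along so that, in a convex combination, the term of one summand can be
  -- dropped.
  let S : Set (P →ᵇ ℝ) := {g | (∀ q, 0 ≤ g q + dist p₀ q) ∧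
    ∃ p : P, ∃ c > 0, ∀ q, c * dist p q ≤ g q + dist p₀ q}
  suffices h : convexHull ℝ (Set.range (pointedKuratowski p₀)) ⊆ S from (h hg).2
  refine convexHull_min ?_ ?_
  · rintro _ ⟨p, rfl⟩
    exact ⟨fun q => by simp, p, 1, one_pos, fun q => by simp⟩
  · rintro f ⟨hf, p, c, hc, hp⟩ g ⟨hg, p', c', hc', hp'⟩ a b ha hb hab
    have key (q : P) : (a • f + b • g) q + dist p₀ q
        = a * (f q + dist p₀ q) + b * (g q + dist p₀ q) := by
      have : dist p₀ q = (a + b) * dist p₀ q := by rw [hab, one_mul]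
      simp only [BoundedContinuousFunction.coe_add, BoundedContinuousFunction.coe_smul,
        Pi.add_apply, smul_eq_mul]
      linear_combination this
    refine ⟨fun q => ?_, ?_⟩
    · rw [key]
      have := hf q
      have := hg q
      positivity
    · rcases ha.eq_or_lt with rfl | ha'
      · obtain rfl : b = 1 := by simpa using hab
        exact ⟨p', c', hc', fun q => by rw [key]; simpa using hp' q⟩
      · refine ⟨p, a * c, by positivity, fun q => ?_⟩
        rw [key, mul_assoc]
        have := mul_nonneg hb (hg q)
        have := mul_le_mul_of_nonneg_left (hp q) ha
        linarith

/-- Every nonempty metric space is closed in the convex hull of its image under the Kuratowski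
embedding. -/
theorem isClosedEmbedding_pointedKuratowski {P : Type*} [MetricSpace P] (p₀ : P) :
    IsClosedEmbedding fun p => (⟨pointedKuratowski p₀ p,
      subset_convexHull ℝ _ (Set.mem_range_self p)⟩ :
        convexHull ℝ (Set.range (pointedKuratowski p₀))) := by
  have hiso : Isometry fun p => (⟨pointedKuratowski p₀ p,
      subset_convexHull ℝ _ (Set.mem_range_self p)⟩ :
        convexHull ℝ (Set.range (pointedKuratowski p₀))) :=
    Isometry.of_dist_eq fun p q => (isometry_pointedKuratowski p₀).dist_eq p q
  refine ⟨hiso.isEmbedding, isClosed_of_closure_subset fun g hg => ?_⟩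
  obtain ⟨p, c, hc, hp⟩ := exists_mul_dist_le_of_mem_convexHull p₀ g.2
  refine ⟨p, Subtype.ext (eq_of_forall_dist_le fun ε hε => ?_)⟩
  obtain ⟨_, ⟨q, rfl⟩, hq⟩ := Metric.mem_closure_iff.1 hg (min (ε / 2) (c * (ε / 2)))
    (by positivity)
  have hq' : dist (g : P →ᵇ ℝ) (pointedKuratowski p₀ q) < min (ε / 2) (c * (ε / 2)) := hq
  -- The left side is the difference at `q` of `g` and the image of `q`; the lower bound for `g`
  -- turns its smallness into closeness of `q` to `p`.
  have h1 : g.1 q + dist p₀ q ≤ dist (g : P →ᵇ ℝ) (pointedKuratowski p₀ q) := by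
    have := BoundedContinuousFunction.dist_coe_le_dist (f := g.1) (g := pointedKuratowski p₀ q) q
    refine le_trans ?_ this
    simpa [Real.dist_eq] using le_abs_self (g.1 q + dist p₀ q)
  have h2 : dist p q < ε / 2 := by
    have := (hp q).trans_lt (h1.trans_lt (hq'.trans_le (min_le_right _ _)))
    exact lt_of_mul_lt_mul_left this hc.le
  have h3 := dist_triangle_right (pointedKuratowski p₀ p) g.1 (pointedKuratowski p₀ q)
  rw [(isometry_pointedKuratowski p₀).dist_eq] at h3
  have := hq'.trans_le (min_le_left _ _)
  linarith

end Kuratowski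

/-! ### Mapping spaces into absolute neighbourhood retracts -/

section MappingSpace

open Set Topology
open scoped BoundedContinuousFunction

/-- If `P` is a neighbourhood retract of a convex subset of a normed space, then the image of
`C(Z, P)` under a closed embedding into a metric space is a neighbourhood retract. -/
theorem isNeighborhoodRetract_range_of_convex {Z P : Type*} {W E : Type*} [TopologicalSpace Z]
    [CompactSpace Z] [T2Space Z] [TopologicalSpace P] [Nonempty P] [MetricSpace W]
    [NormedAddCommGroup E] [NormedSpace ℝ E] {K : Set E} (hK : Convex ℝ K) {e : P → K}
    (he : IsEmbedding e) (hret : IsNeighborhoodRetract (range e)) {i : C(Z, P) → W}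
    (hi : IsClosedEmbedding i) : IsNeighborhoodRetract (range i) := by
  obtain ⟨U, hU, hsub, r, hr⟩ := hret
  let j : C(P, E) := ⟨fun p => e p, continuous_subtype_val.comp he.continuous⟩
  let inv : C(range i, C(Z, P)) := ⟨hi.isEmbedding.toHomeomorph.symm, by fun_prop⟩
  have hinv (φ : C(Z, P)) : inv ⟨i φ, mem_range_self φ⟩ = φ :=
    hi.isEmbedding.toHomeomorph.symm_apply_apply φ
  let f : C(range i, C(Z, E)) :=
    ⟨fun a => j.comp (inv a), j.continuous_postcomp.comp inv.continuous⟩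
  have hKconv : Convex ℝ {ψ : C(Z, E) | ∀ z, ψ z ∈ K} :=
    fun ψ hψ χ hχ a b ha hb hab z => hK (hψ z) (hχ z) ha hb hab
  obtain ⟨F, hF, hFK⟩ := exists_continuous_extension_mem_convex hi.isClosed_range
    ⟨_, mem_range_self (ContinuousMap.const Z (Classical.arbitrary P))⟩ hKconv f fun a z => (e (inv a z)).2
  let G : C(W × Z, K) := ⟨fun w => ⟨F w.1 w.2, hFK w.1 w.2⟩,
    Continuous.subtype_mk (ContinuousMap.uncurry F).continuous _⟩
  have hG (φ : C(Z, P)) (z : Z) : G (i φ, z) = e (φ z) := by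
    refine Subtype.ext ?_
    change F (i φ) z = _
    rw [hF ⟨i φ, mem_range_self φ⟩]
    change (e (inv _ z) : E) = _
    rw [hinv]
  -- Open because `Z` is compact; on it the retraction can be applied pointwise in `z`.
  let V : Set W := {w | ∀ z, G (w, z) ∈ U}
  have hV : IsOpen V := by
    have := (ContinuousMap.isOpen_setOfPred_mapsTo (isCompact_univ (X := Z)) hU).preimage
      G.curry.continuous
    convert! this using 1
    ext w
    simp [V, MapsTo]
  have hVsub : range i ⊆ V := by
    rintro _ ⟨φ, rfl⟩ z
    rw [hG]
    exact hsub (mem_range_self _)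
  let einv : C(range e, P) := ⟨he.toHomeomorph.symm, by fun_prop⟩
  let H : C(V × Z, P) := einv.comp (r.comp
    ⟨fun v => ⟨G (v.1, v.2), v.1.2 v.2⟩, by fun_prop⟩)
  have hH (φ : C(Z, P)) (z : Z) : H (⟨i φ, hVsub (mem_range_self φ)⟩, z) = φ z := by
    have h1 : (⟨G (i φ, z), hVsub (mem_range_self φ) z⟩ : U)
        = ⟨e (φ z), hsub (mem_range_self _)⟩ := Subtype.ext (hG φ z)
    exact (congrArg (fun u => einv (r u)) h1).trans
      ((congrArg einv (hr ⟨e (φ z), mem_range_self _⟩)).trans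
        (he.toHomeomorph.symm_apply_apply (φ z)))
  refine ⟨V, hV, hVsub, ⟨fun v => ⟨i (H.curry v), mem_range_self _⟩,
    (hi.continuous.comp H.curry.continuous).subtype_mk _⟩, ?_⟩
  rintro ⟨_, φ, rfl⟩
  refine Subtype.ext (congrArg i ?_)
  ext z
  exact hH φ z

/-- The space of continuous maps from a compact Hausdorff space to a nonempty ANR is an ANR. -/
theorem IsANR.continuousMap {Z P : Type u} [TopologicalSpace Z] [CompactSpace Z] [T2Space Z]
    [TopologicalSpace P] [Nonempty P] (hP : IsANR P) : IsANR C(Z, P) := by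
  obtain ⟨hmet, hret⟩ := hP
  let _ : MetricSpace P := TopologicalSpace.metrizableSpaceMetric P
  refine ⟨inferInstance, fun W _ _ i hi => ?_⟩
  let _ : MetricSpace W := TopologicalSpace.metrizableSpaceMetric W
  have he := isClosedEmbedding_pointedKuratowski (Classical.arbitrary P)
  exact isNeighborhoodRetract_range_of_convex (convex_convexHull ℝ _) he.isEmbedding
    (hret _ _ he) hi

end MappingSpace

/-! ### Spaces of trivial shape -/

section TrivialShape

theorem isANR_pempty : IsANR PEmpty.{u + 1} :=
  ⟨inferInstance, fun _ _ _ _ _ =>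
    ⟨∅, isOpen_empty, by rintro _ ⟨x, -⟩; exact x.elim, ⟨fun x => x.2.elim, by fun_prop⟩,
      by rintro ⟨_, x, -⟩; exact x.elim⟩⟩

theorem HasTrivialShape.nonempty {X : Type u} [TopologicalSpace X] (hX : HasTrivialShape X) :
    Nonempty X := by
  by_contra h
  rw [not_nonempty_iff] at h
  obtain ⟨y, -⟩ := hX PEmpty isANR_pempty ⟨fun x => h.elim x, by fun_prop⟩
  exact y.elim

theorem HasTrivialShape.congr {X X' : Type u} [TopologicalSpace X] [TopologicalSpace X']
    (e : X ≃ₜ X') (hX : HasTrivialShape X) : HasTrivialShape X' := by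
  intro Y _ hY f
  have h := (hX Y hY (f.comp (e : C(X, X')))).comp_left (e.symm : C(X', X))
  convert! h using 1
  ext x
  simp

/-- A product of a space of trivial shape with a compact Hausdorff space of trivial shape has
trivial shape. -/
theorem HasTrivialShape.prod {X Z : Type u} [TopologicalSpace X] [TopologicalSpace Z]
    [CompactSpace Z] [T2Space Z] (hX : HasTrivialShape X) (hZ : HasTrivialShape Z) :
    HasTrivialShape (X × Z) := by
  intro P _ hP f
  obtain ⟨x⟩ := hX.nonempty
  obtain ⟨z⟩ := hZ.nonempty
  have : Nonempty P := ⟨f (x, z)⟩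
  obtain ⟨g, ⟨H⟩⟩ := hX _ hP.continuousMap f.curry
  obtain ⟨p, hp⟩ := hZ P hP g
  refine ⟨p, ContinuousMap.Homotopic.trans (g := g.comp ContinuousMap.snd) ⟨?_⟩ ?_⟩
  · exact
      { toFun := fun t => H (t.1, t.2.1) t.2.2
        continuous_toFun := (ContinuousMap.uncurry H.toContinuousMap).continuous.comp
          (f := fun t : (Set.Icc (0 : ℝ) 1) × X × Z => ((t.1, t.2.1), t.2.2)) (by fun_prop)
        map_zero_left := fun w => by simp
        map_one_left := fun w => by simp }
  · exact hp.comp (ContinuousMap.Homotopic.refl ContinuousMap.snd)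

end TrivialShape

/-! ### The maximal ideal space of a completed tensor product -/

namespace CompletedTensor

open WeakDual UniformSpace

variable {B C : Type u} [NormedCommRing B] [NormedAlgebra ℂ B]
  [NormedCommRing C] [NormedAlgebra ℂ C] (α : AlgebraNorm ℂ (B ⊗[ℂ] C))

/-- The canonical homomorphism from `B ⊗ C` to its completion. -/
noncomputable def ofTensor : B ⊗[ℂ] C →ₐ[ℂ] CompletedTensor α :=
  AlgHom.mk' (UniformSpace.Completion.coeRingHom.comp (NormedTensor.of α : B ⊗[ℂ] C →+* _))
    fun c x => Completion.coe_smul c (NormedTensor.of α x)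

theorem ofTensor_tmul (b : B) (c : C) : ofTensor α (b ⊗ₜ c) = inclLeft α b * inclRight α c := by
  have : b ⊗ₜ[ℂ] c = (b ⊗ₜ[ℂ] (1 : C)) * ((1 : B) ⊗ₜ[ℂ] c) := by simp
  rw [this, map_mul]
  rfl

theorem denseRange_ofTensor : DenseRange (ofTensor α) :=
  Completion.denseRange_coe.comp (NormedTensor.of α).surjective.denseRange
    (Completion.continuous_coe _)

theorem norm_ofTensor (x : B ⊗[ℂ] C) : ‖ofTensor α x‖ = ‖NormedTensor.of α x‖ :=
  Completion.norm_coe _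

variable [CompleteSpace B] [CompleteSpace C]

/-- Restriction of a character of `B ⊗̂_α C` to the two factors. -/
noncomputable def restrictCharacter (φ : MaximalIdealSpace (CompletedTensor α)) :
    MaximalIdealSpace B × MaximalIdealSpace C :=
  (CharacterSpace.equivAlgHom.symm
      (((CharacterSpace.toAlgHom φ).comp (ofTensor α)).comp Algebra.TensorProduct.includeLeft),
    CharacterSpace.equivAlgHom.symm
      (((CharacterSpace.toAlgHom φ).comp (ofTensor α)).comp Algebra.TensorProduct.includeRight))

theorem restrictCharacter_fst (φ : MaximalIdealSpace (CompletedTensor α)) (b : B) :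
    (restrictCharacter α φ).1 b = φ (inclLeft α b) := rfl

theorem restrictCharacter_snd (φ : MaximalIdealSpace (CompletedTensor α)) (c : C) :
    (restrictCharacter α φ).2 c = φ (inclRight α c) := rfl

theorem continuous_restrictCharacter : Continuous (restrictCharacter α) := by
  have heval (a : CompletedTensor α) :
      Continuous fun φ : MaximalIdealSpace (CompletedTensor α) => φ a :=
    (WeakDual.eval_continuous a).comp continuous_subtype_val
  refine Continuous.prodMk ?_ ?_
  · exact Continuous.subtype_mk (WeakDual.continuous_of_continuous_eval
      fun b => heval (inclLeft α b)) _
  · exact Continuous.subtype_mk (WeakDual.continuous_of_continuous_eval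
      fun c => heval (inclRight α c)) _

theorem restrictCharacter_injective : Function.Injective (restrictCharacter α) := by
  intro φ ψ h
  have hB (b : B) : φ (inclLeft α b) = ψ (inclLeft α b) := by
    rw [← restrictCharacter_fst, h, restrictCharacter_fst]
  have hC (c : C) : φ (inclRight α c) = ψ (inclRight α c) := by
    rw [← restrictCharacter_snd, h, restrictCharacter_snd]
  refine DFunLike.coe_injective ((denseRange_ofTensor α).equalizer (map_continuous φ)
    (map_continuous ψ) (funext fun x => ?_))
  induction x with
  | zero => simp
  | tmul b c => simp [ofTensor_tmul, hB, hC]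
  | add x y hx hy => simpa using congrArg₂ (· + ·) hx hy

/-- Under the slice estimate every pair of characters comes from a character of `B ⊗̂_α C`. -/
theorem restrictCharacter_surjective (hα : SliceEstimate (inclLeft α) (inclRight α)) :
    Function.Surjective (restrictCharacter α) := by
  rintro ⟨ξ, η⟩
  obtain ⟨K, hK⟩ := hα
  let θ : B ⊗[ℂ] C →ₐ[ℂ] ℂ := Algebra.TensorProduct.lift (CharacterSpace.toAlgHom ξ)
    (CharacterSpace.toAlgHom η) fun _ _ => Commute.all _ _
  have hθ (b : B) (c : C) : θ (b ⊗ₜ c) = ξ b * η c := by simp [θ]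
  let θ' : NormedTensor α →ₐ[ℂ] ℂ := θ.comp (NormedTensor.of α).symm.toAlgHom
  -- The factor `‖(1 : C)‖` bounds the norm of `η`, as the unit need not have norm one.
  have hbound (x : NormedTensor α) : ‖θ' x‖ ≤ (‖(1 : C)‖ * K) * ‖x‖ := by
    obtain ⟨x, rfl⟩ := (NormedTensor.of α).surjective x
    change ‖θ x‖ ≤ _
    obtain ⟨n, b, c, rfl⟩ : ∃ (n : ℕ) (b : Fin n → B) (c : Fin n → C),
        x = ∑ k, b k ⊗ₜ[ℂ] c k := by
      obtain ⟨S, rfl⟩ := TensorProduct.exists_finset x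
      refine ⟨S.card, fun k => (S.equivFin.symm k).1.1, fun k => (S.equivFin.symm k).1.2, ?_⟩
      rw [← Finset.sum_coe_sort, ← S.equivFin.symm.sum_comp]
    have h1 : θ (∑ k, b k ⊗ₜ[ℂ] c k) = η (∑ k, ξ (b k) • c k) := by
      simp [hθ]
    have h2 : ‖NormedTensor.of α (∑ k, b k ⊗ₜ[ℂ] c k)‖
        = ‖∑ k, inclLeft α (b k) * inclRight α (c k)‖ := by
      rw [← norm_ofTensor, map_sum]
      simp [ofTensor_tmul]
    rw [h1, h2]
    refine (AlgHom.norm_apply_le_self_mul_norm_one η _).trans ?_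
    rw [mul_comm, mul_assoc]
    exact mul_le_mul_of_nonneg_left (hK ξ n b c) (norm_nonneg _)
  have hcont : Continuous (θ' : NormedTensor α →+* ℂ) :=
    AddMonoidHomClass.continuous_of_bound θ' _ hbound
  let ω : CompletedTensor α →+* ℂ := Completion.extensionHom (θ' : NormedTensor α →+* ℂ) hcont
  have hω (x : B ⊗[ℂ] C) : ω (ofTensor α x) = θ x := Completion.extensionHom_coe _ hcont _
  have hωc : Continuous ω := Completion.continuous_extension
  -- The extension is so far only a ring homomorphism; complex linearity follows by density.
  let ωₐ : CompletedTensor α →ₐ[ℂ] ℂ := AlgHom.mk' ω fun z x => by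
    have h1 : Continuous fun x : CompletedTensor α => ω (z • x) :=
      hωc.comp (continuous_const_smul z)
    have h2 : Continuous fun x : CompletedTensor α => z • ω x := hωc.const_smul z
    refine congrFun ((denseRange_ofTensor α).equalizer h1 h2 (funext fun y => ?_)) x
    simp only [Function.comp_apply, ← map_smul, hω]
  refine ⟨CharacterSpace.equivAlgHom.symm ωₐ, Prod.ext ?_ ?_⟩
  · refine CharacterSpace.ext fun b => ?_
    change ω (ofTensor α (b ⊗ₜ 1)) = ξ b
    rw [hω, hθ, map_one, mul_one]
  · refine CharacterSpace.ext fun c => ?_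
    change ω (ofTensor α (1 ⊗ₜ c)) = η c
    rw [hω, hθ, map_one, one_mul]

/-- Under the slice estimate, `M(B ⊗̂_α C)` is homeomorphic to `M(B) × M(C)`. -/
noncomputable def maximalIdealSpaceHomeomorph
    (hα : SliceEstimate (inclLeft α) (inclRight α)) :
    MaximalIdealSpace (CompletedTensor α) ≃ₜ MaximalIdealSpace B × MaximalIdealSpace C :=
  Continuous.homeoOfEquivCompactToT2
    (f := Equiv.ofBijective (restrictCharacter α)
      ⟨restrictCharacter_injective α, restrictCharacter_surjective α hα⟩)
    (continuous_restrictCharacter α)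

end CompletedTensor

theorem proposition5p5 {B C : Type u}
    [NormedCommRing B] [NormedAlgebra ℂ B] [CompleteSpace B]
    [NormedCommRing C] [NormedAlgebra ℂ C] [CompleteSpace C]
    (α : AlgebraNorm ℂ (B ⊗[ℂ] C))
    (hα : SliceEstimate (CompletedTensor.inclLeft α) (CompletedTensor.inclRight α))
    (hB : BelongsToClassC B) (hC : BelongsToClassC C) :
    BelongsToClassC (CompletedTensor α) ∧
      HasTrivialShape (MaximalIdealSpace B × MaximalIdealSpace C) := by
  have hprod : HasTrivialShape (MaximalIdealSpace B × MaximalIdealSpace C) :=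
    HasTrivialShape.prod hB hC
  exact ⟨hprod.congr (CompletedTensor.maximalIdealSpaceHomeomorph α hα).symm, hprod⟩
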